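/- **Setting.** A switch with $C$ resources serves $K$ nodes; node $n_k$ has $c_k\ge 1$ communication qubits. A flow is an unordered pair of distinct nodes together with one of $T$ session types; $f_1,\dots,f_F$ are all flows, $F=\binom K2 T$, and $n_k\in f$ means that $n_k$ is one of the two nodes of $f$. Flow $f$ issues requests according to a Poisson process of rate $\nu^f\ge 0$ whenever both of its nodes have a free qubit (and none otherwise). A request that sees all $C$ resources engaged is blocked and lost; otherwise it starts a session, which holds one resource and one qubit at each of its two nodes until it ends. A session of flow $f$ is a sequence of attempts and calibration periods, beginning and ending with an attempt, each made of finitely many exponential phases. Phase $i$ has rate $\mu^f_i>0$; on its completion the session goes to phase $j$ with probability $p^f_{i,j}$, where $j$ is either the next phase of the same period or the initial phase of the following period, or else it ends (entanglement has been generated, or the last attempt is over); it cannot end in a calibration period. Let $\tilde p^f_i$ be the probability that a session reaches phase $i$ from its first phase, $\rho^f_i=\nu^f\tilde p^f_i/\mu^f_i$, and $\rho^f=\sum_i\rho^f_i$. The state of the resulting continuous-time Markov chain is the number of sessions in each phase of each flow; it is admissible if there are at most $C$ sessions in total and at most $c_k$ sessions at each node $n_k$. For $h\in\mathbb Z_{\ge0}$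 and $i\in\{1,\dots,F\}$ let $$\mathcal Q(h)=\Big\{q\in\mathbb Z_{\ge0}^F:\ \sum_j q_j=h,\ \sum_{j:\,n_k\in f_j}q_j\le c_k\ \forall k\Big\},$$ $$\mathcal Q'(i)=\Big\{q\in\mathbb Z_{\ge0}^F:\ \sum_{j:\,n_k\in f_j}q_j\le c_k\ \forall n_k\notin f_i,\ \ \sum_{j:\,n_k\in f_j}q_j<c_k\ \forall n_k\in f_i\Big\}.$$ **Theorem.** Let $\nu^{f_i}>0$. The chain has a unique stationary distribution, and the probability that an arriving request of flow $f_i$ is blocked is $$\overline\pi_i(C)=\Big(\sum_{h=0}^{C}\ \sum_{q\in\mathcal Q(h)\cap\mathcal Q'(i)}\ \prod_{j=1}^F\frac{(\rho^{f_j})^{q_j}}{q_j!}\Big)^{-1}\sum_{q\in\mathcal Q(C)\cap\mathcal Q'(i)}\ \prod_{j=1}^F\frac{(\rho^{f_j})^{q_j}}{q_j!}.$$ That is, from every initial distribution on the admissible states, almost surely the number of requests of flow $f_i$ that arrive up to time $t$ tends to infinity as $t\to\infty$, and the fraction of these that are blocked converges to $\overline\pi_i(C)$. Moreover, under the stationary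 distribution both nodes of $f_i$ have a free qubit with positive probability, and $\overline\pi_i(C)$ is the conditional probability that all $C$ resources are engaged, given that both nodes of $f_i$ have a free qubit. -/

import Mathlib

open MeasureTheory Filter Topology

noncomputable section

namespace EGS

/-- The structure of a session under strict resource reservation: a sequence of `M` periods, each of
which is an entanglement generation attempt or a calibration period, the first and the last of them
attempts; period `j` is Coxian, i.e. a sequence of `N j` exponential phases. -/
structure Session where
  M : ℕ
  M_pos : 0 < M
  isCalibration : Fin M → Prop
  first_attempt : ¬ isCalibration ⟨0, M_pos⟩
  last_attempt : ¬ isCalibration ⟨M - 1, Nat.sub_lt M_pos one_pos⟩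
  /-- number of phases of each period -/
  N : Fin M → ℕ
  N_pos : ∀ j, 0 < N j
  /-- service rate of each phase -/
  μ : (Σ j : Fin M, Fin (N j)) → ℝ
  μ_pos : ∀ i, 0 < μ i
  /-- `p i j` is the probability that a session that completes phase `i` proceeds to phase `j` -/
  p : (Σ j : Fin M, Fin (N j)) → (Σ j : Fin M, Fin (N j)) → ℝ
  /-- probability that a session that completes phase `i` ends: a pair was generated, or the last
  attempt is over -/
  leave : (Σ j : Fin M, Fin (N j)) → ℝ
  p_nonneg : ∀ i j, 0 ≤ p i j
  leave_nonneg : ∀ i, 0 ≤ leave i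
  p_sum : ∀ i, ∑ j, p i j + leave i = 1
  /-- a session proceeds to the next phase of the same period, or to the initial phase of the
  following period -/
  p_support : ∀ i j, p i j ≠ 0 →
    ((j.1 : ℕ) = i.1 ∧ (j.2 : ℕ) = i.2 + 1) ∨ ((j.1 : ℕ) = i.1 + 1 ∧ (j.2 : ℕ) = 0)
  /-- a session cannot end during a calibration period -/
  leave_calibration : ∀ i, isCalibration i.1 → leave i = 0

namespace Session

/-- The phases of a session: (period, phase of that period). -/
abbrev Phase (s : Session) : Type := Σ j : Fin s.M, Fin (s.N j)

/-- The first phase of the first attempt. -/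
def first (s : Session) : s.Phase := ⟨⟨0, s.M_pos⟩, ⟨0, s.N_pos _⟩⟩

/-- The probability that a session, started in its first phase, reaches phase `i`. The `n`-th term is
the probability that the `(n+1)`-st phase visited is `i`; as routing only goes forward, these events
are disjoint and only the terms below the number of phases can be nonzero. -/
def reachProb (s : Session) (i : s.Phase) : ℝ :=
  ∑ n ∈ Finset.range (Fintype.card s.Phase), ((Matrix.of s.p) ^ n) s.first i

end Session

/-- A flow: an unordered pair of distinct nodes together with a session type. -/
abbrev Flow (K T : ℕ) : Type := {e : Sym2 (Fin K) // ¬ e.IsDiag} × Fin T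

/-- Node `k` partakes in flow `f`. -/
abbrev Flow.Has {K T : ℕ} (f : Flow K T) (k : Fin K) : Prop := k ∈ f.1.1

/-- An entanglement generation switch with `K` nodes and `T` session types. -/
structure Switch (K T : ℕ) where
  /-- number of resources of the switch -/
  C : ℕ
  /-- number of communication qubits of each node -/
  c : Fin K → ℕ
  c_pos : ∀ k, 1 ≤ c k
  /-- structure of the sessions of each flow -/
  session : Flow K T → Session
  /-- rate at which each flow issues requests (while it is able to) -/
  ν : Flow K T → ℝ
  ν_nonneg : ∀ f, 0 ≤ ν f

namespace Switch

variable {K T : ℕ} (E : Switch K T)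

/-- Traffic intensity of phase `i` of flow `f`: arrival rate into the phase over its service rate. -/
def rhoPhase (f : Flow K T) (i : (E.session f).Phase) : ℝ :=
  E.ν f * (E.session f).reachProb i / (E.session f).μ i

/-- Total traffic intensity of flow `f`. -/
def rho (f : Flow K T) : ℝ := ∑ i, E.rhoPhase f i

/-- `∏_f (ρ^f)^{q_f} / q_f!`. -/
def weight (q : Flow K T → ℕ) : ℝ := ∏ f, E.rho f ^ q f / (q f).factorial

/-- Number of communication qubits of node `k` engaged by `q f` sessions of each flow `f`. -/
def nodeLoad (q : Flow K T → ℕ) (k : Fin K) : ℕ := ∑ f with Flow.Has f k, q f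

/-- `𝒬(h)`: session counts with `h` sessions in total that respect the qubit limits. -/
def Q (h : ℕ) : Finset (Flow K T → ℕ) :=
  (Fintype.piFinset fun _ => Finset.range (h + 1)).filter fun q =>
    ∑ f, q f = h ∧ ∀ k, nodeLoad q k ≤ E.c k

theorem mem_Q (h : ℕ) (q : Flow K T → ℕ) :
    q ∈ E.Q h ↔ ∑ f, q f = h ∧ ∀ k, nodeLoad q k ≤ E.c k := by
  simp only [Q, Finset.mem_filter, Fintype.mem_piFinset, Finset.mem_range, and_iff_right_iff_imp]
  rintro ⟨h1, -⟩ f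
  have := Finset.single_le_sum (f := q) (fun _ _ => Nat.zero_le _) (Finset.mem_univ f)
  omega

/-- `𝒬'(i)`: session counts that respect the qubit limits and leave a free qubit at both nodes
of flow `i`. -/
def Q' (i : Flow K T) : Set (Flow K T → ℕ) :=
  {q | (∀ k, ¬ Flow.Has i k → nodeLoad q k ≤ E.c k) ∧ ∀ k, Flow.Has i k → nodeLoad q k < E.c k}

instance (i : Flow K T) : DecidablePred (· ∈ E.Q' i) := fun q =>
  inferInstanceAs (Decidable ((∀ k, ¬ Flow.Has i k → nodeLoad q k ≤ E.c k) ∧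
    ∀ k, Flow.Has i k → nodeLoad q k < E.c k))

/-- The blocking probability formula. The denominator ranges over all session counts in `𝒬'(i)` with at
most `C` sessions in total, the numerator over those with exactly `C`. -/
def blockingRatio (i : Flow K T) : ℝ :=
  (∑ h ∈ Finset.range (E.C + 1), ∑ q ∈ (E.Q h).filter (· ∈ E.Q' i), E.weight q)⁻¹ *
    ∑ q ∈ (E.Q E.C).filter (· ∈ E.Q' i), E.weight q

/-! ### The Markov chain -/

/-- A state: the number of sessions in each phase of each flow. -/
abbrev State : Type := (f : Flow K T) → (E.session f).Phase → ℕ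

variable {E} in
/-- The number of active sessions of each flow. -/
def count (x : E.State) (f : Flow K T) : ℕ := ∑ i, x f i

/-- The state with a single session, in phase `i` of flow `f`. -/
def unit (f : Flow K T) (i : (E.session f).Phase) : E.State := Pi.single f (Pi.single i 1)

/-- The admissible states. -/
def S : Finset E.State :=
  (Fintype.piFinset fun _ => Fintype.piFinset fun _ => Finset.range (E.C + 1)).filter fun x =>
    ∑ f, count x f ≤ E.C ∧ ∀ k, nodeLoad (count x) k ≤ E.c k

theorem mem_S (x : E.State) :
    x ∈ E.S ↔ ∑ f, count x f ≤ E.C ∧ ∀ k, nodeLoad (count x) k ≤ E.c k := by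
  simp only [S, Finset.mem_filter, Fintype.mem_piFinset, Finset.mem_range, and_iff_right_iff_imp]
  rintro ⟨h1, -⟩ f i
  have h2 := Finset.single_le_sum (f := count x) (fun _ _ => Nat.zero_le _) (Finset.mem_univ f)
  have h3 := Finset.single_le_sum (f := x f) (fun _ _ => Nat.zero_le _) (Finset.mem_univ i)
  unfold count at h1 h2
  omega

/-- The events that can happen: `inl f` is a request of flow `f`; `inr ⟨f, i, some j⟩` is a session
of flow `f` proceeding from phase `i` to phase `j`, `inr ⟨f, i, none⟩` one ending after phase `i`. -/
abbrev Event : Type :=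
  Flow K T ⊕ (Σ f : Flow K T, (E.session f).Phase × Option (E.session f).Phase)

/-- The rate of each event in state `x`. A flow issues requests only while both of its nodes have a
free qubit. -/
def rate (x : E.State) : E.Event → ℝ
  | .inl f => if ∀ k, Flow.Has f k → nodeLoad (count x) k < E.c k then E.ν f else 0
  | .inr ⟨f, i, some j⟩ => x f i * (E.session f).μ i * (E.session f).p i j
  | .inr ⟨f, i, none⟩ => x f i * (E.session f).μ i * (E.session f).leave i

/-- The total rate of events in state `x`. -/
def totalRate (x : E.State) : ℝ := ∑ e, E.rate x e

/-- The state after each event. A request is admitted, and its session starts in the first phase, if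
the resulting state is admissible; otherwise it is lost. -/
def step (x : E.State) : E.Event → E.State
  | .inl f => if x + E.unit f (E.session f).first ∈ E.S then x + E.unit f (E.session f).first else x
  | .inr ⟨f, i, some j⟩ => x - E.unit f i + E.unit f j
  | .inr ⟨f, i, none⟩ => x - E.unit f i

/-- `π` is a stationary distribution of the chain: a probability distribution on the admissible
states that satisfies the global balance equations. -/
structure IsStationary (π : E.State → ℝ) : Prop where
  nonneg : ∀ x, 0 ≤ π x
  eq_zero : ∀ x, x ∉ E.S → π x = 0
  sum_eq_one : ∑ x ∈ E.S, π x = 1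
  balance : ∀ y ∈ E.S, π y * E.totalRate y =
    ∑ x ∈ E.S, ∑ e, if E.step x e = y then π x * E.rate x e else 0

/-- The system as a random process, in its jump chain / holding time description: the successive
states `X n`, the time `τ n` spent in `X n` until the next event, and this event `ev n`. Given the past,
the events compete as independent exponential clocks with rates `rate (X n)`. The initial state is
an arbitrary (random) admissible one. -/
structure IsTrajectory {Ω : Type*} {m : MeasurableSpace Ω} (P : Measure Ω) (ℱ : Filtration ℕ m)
    (X : ℕ → Ω → E.State) (τ : ℕ → Ω → ℝ) (ev : ℕ → Ω → E.Event) : Prop where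
  measurable_X : ∀ n, Measurable[ℱ n] (X n)
  measurable_τ : ∀ n, Measurable[ℱ (n + 1)] (τ n)
  measurable_ev : ∀ n e, MeasurableSet[ℱ (n + 1)] {ω | ev n ω = e}
  initial : ∀ᵐ ω ∂P, X 0 ω ∈ E.S
  next : ∀ n, ∀ᵐ ω ∂P, X (n + 1) ω = E.step (X n ω) (ev n ω)
  law : ∀ n e (s : ℝ), 0 ≤ s →
    P[Set.indicator {ω | ev n ω = e ∧ s < τ n ω} (fun _ => (1 : ℝ)) | ℱ n] =ᵐ[P]
      fun ω => E.rate (X n ω) e / E.totalRate (X n ω) * Real.exp (-(E.totalRate (X n ω) * s))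

variable {E}

/-- The time at which the event `ev n` happens. -/
def eventTime {Ω : Type*} (τ : ℕ → Ω → ℝ) (n : ℕ) (ω : Ω) : ℝ := ∑ k ∈ Finset.range (n + 1), τ k ω

/-- The number of requests of flow `i` that arrive up to time `t`. -/
def numRequests {Ω : Type*} (τ : ℕ → Ω → ℝ) (ev : ℕ → Ω → E.Event) (i : Flow K T) (t : ℝ)
    (ω : Ω) : ℕ :=
  {n | eventTime τ n ω ≤ t ∧ ev n ω = .inl i}.ncard

/-- The number of requests of flow `i` up to time `t` that are blocked, i.e. that upon arrival see
all `C` resources engaged. -/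
def numBlocked {Ω : Type*} (X : ℕ → Ω → E.State) (τ : ℕ → Ω → ℝ) (ev : ℕ → Ω → E.Event)
    (i : Flow K T) (t : ℝ) (ω : Ω) : ℕ :=
  {n | eventTime τ n ω ≤ t ∧ ev n ω = .inl i ∧ ∑ f, count (X n ω) f = E.C}.ncard

end Switch

end EGS

end

/-! ### Routing inside a session -/

noncomputable section

/-! Routing in a session only goes forward, so its matrix is nilpotent and the reach probabilities
`r` solve `r = e_first + r p`, with total exit mass 1. These traffic equations give the weights `∏
ρ_i ^ x_i / x_i !` partial balance: for each flow and each state `z` with room for one more of its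
sessions, the flux between `z` and the states with one extra session cancels, since admissibility
depends only on counts per flow (`sum_stateWeight_gen`). The multinomial theorem sums out the
phases, leaving powers of the total intensities, hence the stated ratio.

The chain need not be irreducible: vanishing rates or routing probabilities may make states
unreachable. But the empty state can be reached from every state, so by the maximum principle
harmonic functions are constant. By finite dimension every function is then in the range of the
generator up to a constant (`exists_gen_add_const`); this yields uniqueness and the Poisson
equation.

For the long run, a solution of the Poisson equation turns centered sums along a trajectory into a
martingale plus a bounded term, and the strong law for bounded martingale differences applies
(`ae_tendsto_average`). Flow `i` requests at the same rate in every state of `𝒬'(i)`, so this rate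
cancels between blocked and all requests. Event times tend to infinity, so frequencies per event
become fractions up to time `t` (`tendsto_ncard_div_ncard`). -/

/-- A strictly upper triangular matrix is nilpotent. -/
theorem Matrix.pow_card_eq_zero_of_strictUpper {ι R : Type*} [Fintype ι] [DecidableEq ι]
    [LinearOrder ι] [CommRing R] (A : Matrix ι ι R) (hA : ∀ i j, A i j ≠ 0 → i < j) :
    A ^ Fintype.card ι = 0 := by
  have h1 : A.charpoly = Polynomial.X ^ Fintype.card ι := by
    rw [Matrix.charpoly_of_isUpperTriangular]
    · have : ∀ i, A i i = 0 := fun i => by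
        by_contra h
        exact lt_irrefl _ (hA i i h)
      simp [this]
    · intro i j hij
      by_contra h
      exact lt_asymm hij (hA i j h)
  -- Cayley–Hamilton.
  simpa [h1] using A.aeval_self_charpoly

namespace EGS

namespace Session

variable (s : Session)

/-- The phases in the order in which they are visited. -/
@[reducible] def phaseOrder : LinearOrder s.Phase :=
  inferInstanceAs (LinearOrder (Σₗ j : Fin s.M, Fin (s.N j)))

theorem lt_of_p_ne_zero {i j : s.Phase} (h : s.p i j ≠ 0) : s.phaseOrder.lt i j := by
  change Sigma.Lex _ _ _ _
  obtain ⟨i1, i2⟩ := i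
  obtain ⟨j1, j2⟩ := j
  rcases s.p_support _ _ h with ⟨h1, h2⟩ | ⟨h1, h2⟩
  · obtain rfl : j1 = i1 := Fin.ext h1
    refine Sigma.Lex.right _ _ ?_
    simp only at h2
    change i2 < j2
    rw [Fin.lt_def]
    omega
  · refine Sigma.Lex.left _ _ ?_
    simp only at h1
    change i1 < j1
    rw [Fin.lt_def]
    omega

theorem pow_card_eq_zero : (Matrix.of s.p) ^ Fintype.card s.Phase = 0 := by
  let := s.phaseOrder
  exact Matrix.pow_card_eq_zero_of_strictUpper _ fun i j h => s.lt_of_p_ne_zero h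

/-- Traffic equations: the finite geometric series of a nilpotent matrix inverts `1 - p`. -/
theorem reachProb_recursion (i : s.Phase) :
    ∑ j, s.reachProb j * s.p j i = s.reachProb i - if i = s.first then 1 else 0 := by
  have h := geom_sum_mul (Matrix.of s.p) (Fintype.card s.Phase)
  rw [s.pow_card_eq_zero, mul_sub, mul_one, zero_sub, sub_eq_iff_eq_add] at h
  have h2 := congr_fun (congr_fun h s.first) i
  simp only [Matrix.mul_apply, Matrix.sum_apply, Matrix.add_apply, Matrix.neg_apply,
    Matrix.one_apply, Matrix.of_apply] at h2
  simp only [reachProb]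
  rw [h2]
  simp only [eq_comm]
  ring

/-- Sum the traffic equations over all phases: the unit of mass entering at the first phase must
leave. -/
theorem reachProb_leave : ∑ i, s.reachProb i * s.leave i = 1 := by
  have h : ∀ i, s.leave i = 1 - ∑ j, s.p i j := fun i => by linarith [s.p_sum i]
  simp_rw [h, mul_sub, mul_one, Finset.mul_sum, Finset.sum_sub_distrib]
  rw [Finset.sum_comm]
  simp_rw [s.reachProb_recursion]
  simp

theorem reachProb_nonneg (i : s.Phase) : 0 ≤ s.reachProb i := by
  have h : ∀ n i j, 0 ≤ ((Matrix.of s.p) ^ n) i j := by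
    intro n
    induction n with
    | zero =>
      intro i j
      rw [pow_zero, Matrix.one_apply]
      split_ifs <;> norm_num
    | succ n ih =>
      intro i j
      rw [pow_succ, Matrix.mul_apply]
      exact Finset.sum_nonneg fun k _ => mul_nonneg (ih i k) (s.p_nonneg k j)
  exact Finset.sum_nonneg fun n _ => h n _ _

open scoped Classical in
/-- The number of phases from phase `i` on. -/
def depth (i : s.Phase) : ℕ := (Finset.univ.filter fun j => s.phaseOrder.lt i j).card + 1

theorem depth_lt {i j : s.Phase} (h : s.p i j ≠ 0) : s.depth j < s.depth i := by
  have hlt := s.lt_of_p_ne_zero h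
  unfold depth
  refine Nat.succ_lt_succ (Finset.card_lt_card
    ((Finset.ssubset_iff_of_subset ?_).2 ⟨j, ?_, ?_⟩))
  · intro k hk
    simp only [Finset.mem_filter, Finset.mem_univ, true_and] at hk ⊢
    exact @lt_trans _ s.phaseOrder.toPreorder _ _ _ hlt hk
  · simpa using hlt
  · simp [@lt_irrefl _ s.phaseOrder.toPreorder j]

end Session

end EGS

end

/-! ### States, events and the generator -/

noncomputable section

namespace EGS

namespace Switch

variable {K T : ℕ} (E : Switch K T)

theorem count_zero : count (0 : E.State) = 0 := by
  funext f
  simp [count]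

theorem count_add (x y : E.State) : count (x + y) = count x + count y := by
  funext f
  simp [count, Finset.sum_add_distrib]

theorem count_unit (f : Flow K T) (i : (E.session f).Phase) :
    count (E.unit f i) = Pi.single f 1 := by
  funext g
  rcases eq_or_ne g f with rfl | h
  · simp [count, unit]
  · simp [count, unit, h]

theorem count_add_unit (x : E.State) (f : Flow K T) (i j : (E.session f).Phase) :
    count (x + E.unit f i) = count (x + E.unit f j) := by
  rw [count_add, count_add, count_unit, count_unit]

theorem nodeLoad_add (p q : Flow K T → ℕ) (k : Fin K) :
    nodeLoad (p + q) k = nodeLoad p k + nodeLoad q k := by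
  simp [nodeLoad, Finset.sum_add_distrib]

theorem nodeLoad_single (f : Flow K T) (k : Fin K) :
    nodeLoad (Pi.single f 1) k = if Flow.Has f k then 1 else 0 := by
  simp [nodeLoad, Finset.sum_pi_single']

theorem nodeLoad_zero (k : Fin K) : nodeLoad (0 : Flow K T → ℕ) k = 0 := by
  simp [nodeLoad]

theorem zero_mem_S : (0 : E.State) ∈ E.S := by
  rw [mem_S, count_zero]
  simp [nodeLoad_zero]

theorem mem_S_of_add {x y : E.State} (h : x + y ∈ E.S) : x ∈ E.S := by
  rw [mem_S] at h ⊢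
  simp only [count_add, nodeLoad_add, Pi.add_apply, Finset.sum_add_distrib] at h
  exact ⟨by omega, fun k => by have := h.2 k; omega⟩

theorem add_unit_mem_S_iff (x : E.State) (f : Flow K T) (i j : (E.session f).Phase) :
    x + E.unit f i ∈ E.S ↔ x + E.unit f j ∈ E.S := by
  rw [mem_S, mem_S, E.count_add_unit x f i j]

theorem free_of_add_unit_mem_S {x : E.State} {f : Flow K T} {i : (E.session f).Phase}
    (h : x + E.unit f i ∈ E.S) (k : Fin K) (hk : Flow.Has f k) :
    nodeLoad (count x) k < E.c k := by
  rw [mem_S] at h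
  have := h.2 k
  rw [count_add, nodeLoad_add, count_unit, nodeLoad_single, if_pos hk] at this
  omega

theorem unit_self (f : Flow K T) (i : (E.session f).Phase) : E.unit f i f i = 1 := by
  simp [unit]

theorem unit_of_ne (f : Flow K T) {i j : (E.session f).Phase} (h : j ≠ i) :
    E.unit f i f j = 0 := by
  simp [unit, h]

theorem unit_of_ne_flow {f g : Flow K T} (i : (E.session f).Phase) (h : g ≠ f) :
    E.unit f i g = 0 := by
  simp [unit, h]

theorem sub_add_unit {x : E.State} {f : Flow K T} {i : (E.session f).Phase} (h : x f i ≠ 0) :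
    x - E.unit f i + E.unit f i = x := by
  funext g j
  rcases eq_or_ne g f with rfl | hg
  · rcases eq_or_ne j i with rfl | hj
    · simp only [Pi.add_apply, Pi.sub_apply, unit_self]
      omega
    · simp [E.unit_of_ne _ hj]
  · simp [E.unit_of_ne_flow _ hg]

theorem add_sub_unit (x : E.State) (f : Flow K T) (i : (E.session f).Phase) :
    x + E.unit f i - E.unit f i = x := by
  funext g j
  simp

theorem rate_nonneg (x : E.State) (e : E.Event) : 0 ≤ E.rate x e := by
  match e with
  | .inl f =>
    simp only [rate]
    split_ifs
    exacts [E.ν_nonneg f, le_rfl]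
  | .inr ⟨f, i, some j⟩ =>
    exact mul_nonneg (mul_nonneg (Nat.cast_nonneg _) ((E.session f).μ_pos i).le)
      ((E.session f).p_nonneg i j)
  | .inr ⟨f, i, none⟩ =>
    exact mul_nonneg (mul_nonneg (Nat.cast_nonneg _) ((E.session f).μ_pos i).le)
      ((E.session f).leave_nonneg i)

/-- A nonzero rate guarantees a session in the departing phase; otherwise truncated subtraction
removes nothing, and the step could leave `S`. -/
theorem step_mem_S {x : E.State} (hx : x ∈ E.S) {e : E.Event} (he : E.rate x e ≠ 0) :
    E.step x e ∈ E.S := by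
  match e with
  | .inl f =>
    simp only [step]
    split_ifs with h
    exacts [h, hx]
  | .inr ⟨f, i, some j⟩ =>
    have h0 : x f i ≠ 0 := fun h => he (by simp [rate, h])
    simp only [step]
    rw [E.add_unit_mem_S_iff _ f j i, E.sub_add_unit h0]
    exact hx
  | .inr ⟨f, i, none⟩ =>
    have h0 : x f i ≠ 0 := fun h => he (by simp [rate, h])
    simp only [step]
    exact E.mem_S_of_add (y := E.unit f i) (by rwa [E.sub_add_unit h0])

/-- The generator of the chain. -/
def gen (h : E.State → ℝ) (x : E.State) : ℝ := ∑ e, E.rate x e * (h (E.step x e) - h x)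

/-- A function is orthogonal to the range of the generator iff it satisfies the balance equations. -/
theorem balance_iff (π : E.State → ℝ) :
    (∀ y ∈ E.S, π y * E.totalRate y =
      ∑ x ∈ E.S, ∑ e, if E.step x e = y then π x * E.rate x e else 0) ↔
    ∀ h : E.State → ℝ, ∑ x ∈ E.S, π x * E.gen h x = 0 := by
  have key : ∀ h : E.State → ℝ, ∑ x ∈ E.S, π x * E.gen h x =
      ∑ y ∈ E.S, h y * ((∑ x ∈ E.S, ∑ e, if E.step x e = y then π x * E.rate x e else 0) -
        π y * E.totalRate y) := by
    intro h
    simp only [mul_sub, Finset.sum_sub_distrib, gen, Finset.mul_sum]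
    congr 1
    · conv_rhs => rw [Finset.sum_comm]
      refine Finset.sum_congr rfl fun x hx => ?_
      conv_rhs => rw [Finset.sum_comm]
      refine Finset.sum_congr rfl fun e _ => ?_
      by_cases he : E.rate x e = 0
      · simp [he]
      · rw [Finset.sum_eq_single_of_mem _ (E.step_mem_S hx he)]
        · simp; ring
        · intro y _ hy
          simp [hy.symm]
    · refine Finset.sum_congr rfl fun x _ => ?_
      rw [totalRate, Finset.mul_sum, Finset.mul_sum]
      exact Finset.sum_congr rfl fun e _ => by ring
  constructor
  · intro hb h
    rw [key]
    exact Finset.sum_eq_zero fun y hy => by rw [hb y hy]; ring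
  · intro hb y hy
    -- Testing against the indicator of `y` isolates the balance equation at `y`.
    have := hb (Pi.single y 1)
    rw [key, Finset.sum_eq_single_of_mem y hy] at this
    · simp only [Pi.single_eq_same, one_mul] at this
      linarith
    · intro z _ hz
      simp [hz]

/-! ### Product form by partial balance -/

/-- The unnormalized stationary distribution. -/
def stateWeight (x : E.State) : ℝ := ∏ f, ∏ i, E.rhoPhase f i ^ x f i / (x f i).factorial

theorem rhoPhase_nonneg (f : Flow K T) (i : (E.session f).Phase) : 0 ≤ E.rhoPhase f i :=
  div_nonneg (mul_nonneg (E.ν_nonneg f) ((E.session f).reachProb_nonneg i))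
    ((E.session f).μ_pos i).le

theorem rhoPhase_mul_μ (f : Flow K T) (i : (E.session f).Phase) :
    E.rhoPhase f i * (E.session f).μ i = E.ν f * (E.session f).reachProb i :=
  div_mul_cancel₀ _ ((E.session f).μ_pos i).ne'

theorem stateWeight_nonneg (x : E.State) : 0 ≤ E.stateWeight x :=
  Finset.prod_nonneg fun f _ => Finset.prod_nonneg fun i _ =>
    div_nonneg (pow_nonneg (E.rhoPhase_nonneg f i) _) (Nat.cast_nonneg _)

theorem stateWeight_zero : E.stateWeight 0 = 1 := by
  simp [stateWeight]

theorem stateWeight_add_unit (z : E.State) (f : Flow K T) (i : (E.session f).Phase) :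
    E.stateWeight (z + E.unit f i) * (z f i + 1) = E.stateWeight z * E.rhoPhase f i := by
  have hf : E.stateWeight (z + E.unit f i) = (∏ g ∈ Finset.univ.erase f, ∏ j,
      E.rhoPhase g j ^ z g j / (z g j).factorial) *
      ∏ j, E.rhoPhase f j ^ (z + E.unit f i) f j / ((z + E.unit f i) f j).factorial := by
    rw [stateWeight, ← Finset.prod_erase_mul _ _ (Finset.mem_univ f)]
    congr 1
    refine Finset.prod_congr rfl fun g hg => ?_
    simp [E.unit_of_ne_flow i (Finset.ne_of_mem_erase hg)]
  have hi : ∏ j, E.rhoPhase f j ^ (z + E.unit f i) f j / ((z + E.unit f i) f j).factorial =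
      (∏ j ∈ Finset.univ.erase i, E.rhoPhase f j ^ z f j / (z f j).factorial) *
        (E.rhoPhase f i ^ (z f i + 1) / (z f i + 1).factorial) := by
    rw [← Finset.prod_erase_mul _ _ (Finset.mem_univ i)]
    congr 1
    · refine Finset.prod_congr rfl fun j hj => ?_
      simp [E.unit_of_ne f (Finset.ne_of_mem_erase hj)]
    · simp [unit_self]
  rw [hf, hi, stateWeight, ← Finset.prod_erase_mul _ _ (Finset.mem_univ f),
    ← Finset.prod_erase_mul _ _ (Finset.mem_univ i), Nat.factorial_succ]
  have h1 : ((z f i).factorial : ℝ) ≠ 0 := by positivity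
  have h2 : (z f i : ℝ) + 1 ≠ 0 := by positivity
  push_cast
  field_simp
  ring

/-- The states in which a request of flow `f` can be admitted. -/
def admitting (f : Flow K T) : Finset E.State :=
  E.S.filter fun z => z + E.unit f (E.session f).first ∈ E.S

/-- Substitute `x = z + unit f i`; states without a session in phase `i` contribute nothing. The
range of `z` is the same for all `i`, which lets the phases of a flow cancel pointwise in `z`. -/
theorem sum_stateWeight_mul (f : Flow K T) (i : (E.session f).Phase) (F : E.State → ℝ) :
    ∑ x ∈ E.S, E.stateWeight x * (x f i * F x) =
      ∑ z ∈ E.admitting f, E.stateWeight z * (E.rhoPhase f i * F (z + E.unit f i)) := by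
  rw [← Finset.sum_filter_of_ne (p := fun x => x f i ≠ 0)
    (fun x _ h h0 => h (by simp [h0]))]
  refine Finset.sum_nbij' (fun x => x - E.unit f i) (fun z => z + E.unit f i) ?_ ?_ ?_ ?_ ?_
  · intro x hx
    obtain ⟨hx, h0⟩ := Finset.mem_filter.1 hx
    refine Finset.mem_filter.2 ⟨E.mem_S_of_add (y := E.unit f i) ?_, ?_⟩
    · rwa [E.sub_add_unit h0]
    · rwa [E.add_unit_mem_S_iff _ f _ i, E.sub_add_unit h0]
  · intro z hz
    obtain ⟨hz, h0⟩ := Finset.mem_filter.1 hz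
    refine Finset.mem_filter.2 ⟨(E.add_unit_mem_S_iff _ f _ _).1 h0, ?_⟩
    simp [unit_self]
  · intro x hx
    exact E.sub_add_unit (Finset.mem_filter.1 hx).2
  · intro z _
    exact E.add_sub_unit z f i
  · intro x hx
    have h0 := (Finset.mem_filter.1 hx).2
    rw [E.sub_add_unit h0, ← mul_assoc, ← mul_assoc, ← E.stateWeight_add_unit,
      E.sub_add_unit h0]
    congr 2
    simp only [Pi.sub_apply, unit_self]
    rw [← Nat.cast_add_one]
    congr 1
    omega

/-- The free-qubit condition and the admission test merge: an admissible successor forces free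
qubits, and a blocked request does not change the state. -/
theorem gen_eq {h : E.State → ℝ} {x : E.State} (hx : x ∈ E.S) :
    E.gen h x = ∑ f, ((if x ∈ E.admitting f then
        E.ν f * (h (x + E.unit f (E.session f).first) - h x) else 0) +
      ∑ i, x f i * ((E.session f).μ i *
        (∑ j, (E.session f).p i j * (h (x - E.unit f i + E.unit f j) - h x) +
          (E.session f).leave i * (h (x - E.unit f i) - h x)))) := by
  rw [gen, Fintype.sum_sum_type, Fintype.sum_sigma, Finset.sum_add_distrib]
  congr 1
  · refine Finset.sum_congr rfl fun f _ => ?_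
    by_cases h1 : x + E.unit f (E.session f).first ∈ E.S
    · rw [if_pos (show x ∈ E.admitting f from Finset.mem_filter.2 ⟨hx, h1⟩)]
      simp only [step, rate, if_pos h1]
      rw [if_pos (E.free_of_add_unit_mem_S h1)]
    · rw [if_neg (show x ∉ E.admitting f from fun h2 => h1 (Finset.mem_filter.1 h2).2)]
      simp [step, h1]
  · refine Finset.sum_congr rfl fun f _ => ?_
    rw [Fintype.sum_prod_type]
    refine Finset.sum_congr rfl fun i _ => ?_
    rw [Fintype.sum_option]
    simp only [rate, step, mul_add, Finset.mul_sum]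
    rw [add_comm]
    congr 1
    · exact Finset.sum_congr rfl fun j _ => by ring
    · ring

/-- After the substitution, the coefficient of each `stateWeight z`, for each flow separately,
vanishes by the traffic equations and the unit exit mass. -/
theorem sum_stateWeight_gen (h : E.State → ℝ) :
    ∑ x ∈ E.S, E.stateWeight x * E.gen h x = 0 := by
  rw [Finset.sum_congr rfl fun x hx => by rw [E.gen_eq hx]]
  simp_rw [Finset.mul_sum]
  rw [Finset.sum_comm]
  refine Finset.sum_eq_zero fun f _ => ?_
  simp_rw [mul_add (E.stateWeight _)]
  rw [Finset.sum_add_distrib]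
  have h1 : ∑ x ∈ E.S, E.stateWeight x * (if x ∈ E.admitting f then
      E.ν f * (h (x + E.unit f (E.session f).first) - h x) else 0) =
      ∑ z ∈ E.admitting f, E.stateWeight z *
        (E.ν f * (h (z + E.unit f (E.session f).first) - h z)) := by
    simp_rw [mul_ite, mul_zero]
    rw [← Finset.sum_filter]
    refine Finset.sum_congr ?_ fun _ _ => rfl
    ext z
    simp only [admitting, Finset.mem_filter]
    tauto
  have h1' : ∀ F : (E.session f).Phase → E.State → ℝ,
      ∑ x ∈ E.S, E.stateWeight x * ∑ i, x f i * F i x =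
        ∑ z ∈ E.admitting f, E.stateWeight z *
          ∑ i, E.rhoPhase f i * F i (z + E.unit f i) := by
    intro F
    simp_rw [Finset.mul_sum]
    rw [Finset.sum_comm, Finset.sum_comm (s := E.admitting f)]
    exact Finset.sum_congr rfl fun i _ => E.sum_stateWeight_mul f i (F i)
  rw [h1, h1' fun i x => (E.session f).μ i *
    (∑ j, (E.session f).p i j * (h (x - E.unit f i + E.unit f j) - h x) +
      (E.session f).leave i * (h (x - E.unit f i) - h x)), ← Finset.sum_add_distrib]
  refine Finset.sum_eq_zero fun z _ => ?_
  rw [← mul_add]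
  convert mul_zero _
  simp_rw [E.add_sub_unit, ← mul_assoc, E.rhoPhase_mul_μ, mul_assoc, ← Finset.mul_sum, ← mul_add]
  convert mul_zero _
  have h2 : ∀ i, ∑ j, (E.session f).p i j * (h (z + E.unit f j) - h (z + E.unit f i)) +
      (E.session f).leave i * (h z - h (z + E.unit f i)) =
      ∑ j, (E.session f).p i j * h (z + E.unit f j) + (E.session f).leave i * h z - h (z + E.unit f i) := by
    intro i
    simp_rw [mul_sub, Finset.sum_sub_distrib, ← Finset.sum_mul]
    linear_combination
      (-h (z + E.unit f i)) * (E.session f).p_sum i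
  have h3 : ∑ i, (E.session f).reachProb i * ∑ j, (E.session f).p i j * h (z + E.unit f j) =
      ∑ j, (E.session f).reachProb j * h (z + E.unit f j) - h (z + E.unit f (E.session f).first) := by
    simp_rw [Finset.mul_sum]
    rw [Finset.sum_comm]
    simp_rw [← mul_assoc, ← Finset.sum_mul, (E.session f).reachProb_recursion, sub_mul,
      Finset.sum_sub_distrib]
    simp
  simp_rw [h2, mul_sub, mul_add, Finset.sum_sub_distrib, Finset.sum_add_distrib, h3, ← mul_assoc,
    ← Finset.sum_mul, (E.session f).reachProb_leave]
  ring

/-- The normalization constant. -/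
def normalization : ℝ := ∑ x ∈ E.S, E.stateWeight x

theorem normalization_pos : 0 < E.normalization :=
  Finset.sum_pos' (fun x _ => E.stateWeight_nonneg x)
    ⟨0, E.zero_mem_S, by rw [stateWeight_zero]; exact one_pos⟩

/-- The stationary distribution. -/
def stationary (x : E.State) : ℝ := if x ∈ E.S then E.stateWeight x / E.normalization else 0

theorem stationary_of_mem {x : E.State} (hx : x ∈ E.S) :
    E.stationary x = E.stateWeight x / E.normalization := if_pos hx

theorem isStationary_stationary : E.IsStationary E.stationary where
  nonneg x := by
    unfold stationary
    split_ifs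
    exacts [div_nonneg (E.stateWeight_nonneg x) E.normalization_pos.le, le_rfl]
  eq_zero x hx := if_neg hx
  sum_eq_one := by
    rw [Finset.sum_congr rfl fun x hx => E.stationary_of_mem hx, ← Finset.sum_div]
    exact div_self E.normalization_pos.ne'
  balance := by
    rw [balance_iff]
    intro h
    rw [Finset.sum_congr rfl fun x hx => by
      rw [E.stationary_of_mem hx, div_mul_eq_mul_div], ← Finset.sum_div,
      E.sum_stateWeight_gen, zero_div]

/-! ### Uniqueness and the Poisson equation -/

/-- The number of phases that the active sessions may still have to go through. -/
def remaining (x : E.State) : ℕ := ∑ f, ∑ i, x f i * (E.session f).depth i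

theorem remaining_add_unit (x : E.State) (f : Flow K T) (i : (E.session f).Phase) :
    E.remaining (x + E.unit f i) = E.remaining x + (E.session f).depth i := by
  simp only [remaining, Pi.add_apply, add_mul, Finset.sum_add_distrib]
  congr 1
  rw [Finset.sum_eq_single f, Finset.sum_eq_single i]
  · rw [unit_self, one_mul]
  · intro j _ hj
    rw [E.unit_of_ne _ hj, zero_mul]
  · simp
  · intro g _ hg
    simp [E.unit_of_ne_flow _ hg]
  · simp

/-- Since `p_sum` is 1, any active session can end or move forward. Iterating, every state can drain
to the empty one. -/
theorem exists_step_remaining_lt {x : E.State} (hx : x ≠ 0) :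
    ∃ e, 0 < E.rate x e ∧ E.remaining (E.step x e) < E.remaining x := by
  obtain ⟨f, hf⟩ := Function.ne_iff.1 hx
  obtain ⟨i, hi⟩ := Function.ne_iff.1 hf
  have hi : x f i ≠ 0 := hi
  have hxi : (0 : ℝ) < x f i := by positivity
  have hμ := (E.session f).μ_pos i
  have hr := E.remaining_add_unit (x - E.unit f i) f i
  rw [E.sub_add_unit hi] at hr
  by_cases hl : (E.session f).leave i = 0
  · have : ∃ j, (E.session f).p i j ≠ 0 := by
      by_contra! h
      have := (E.session f).p_sum i
      simp [h, hl] at this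
    obtain ⟨j, hj⟩ := this
    refine ⟨.inr ⟨f, i, some j⟩,
      mul_pos (mul_pos hxi hμ) (((E.session f).p_nonneg i j).lt_of_ne' hj), ?_⟩
    have := (E.session f).depth_lt hj
    simp only [step]
    rw [remaining_add_unit]
    omega
  · refine ⟨.inr ⟨f, i, none⟩,
      mul_pos (mul_pos hxi hμ) (((E.session f).leave_nonneg i).lt_of_ne' hl), ?_⟩
    -- The `+ 1` in `depth` makes even an exit from a last phase count as a decrease.
    have : 0 < (E.session f).depth i := Nat.succ_pos _
    simp only [step]
    omega

/-- The maximum principle: a harmonic function attains its maximum at the empty state. -/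
theorem le_of_gen_eq_zero {h : E.State → ℝ} (hh : ∀ x ∈ E.S, E.gen h x = 0) :
    ∀ x ∈ E.S, h x ≤ h 0 := by
  obtain ⟨m, hm, hmax⟩ := Finset.exists_max_image E.S h ⟨0, E.zero_mem_S⟩
  suffices H : ∀ n, ∀ x ∈ E.S, E.remaining x = n → h x = h m → h 0 = h m by
    intro x hx
    rw [H _ m hm rfl rfl]
    exact hmax x hx
  intro n
  induction n using Nat.strong_induction_on with
  | _ n ih =>
    intro x hx hn hxm
    by_cases h0 : x = 0
    · rw [← h0, hxm]
    obtain ⟨e, he, hlt⟩ := E.exists_step_remaining_lt h0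
    have hs := E.step_mem_S hx he.ne'
    refine ih _ (hn ▸ hlt) _ hs rfl ?_
    -- At a maximum all terms of `gen h x` are nonpositive; their sum is zero, so every successor of
    -- positive rate is also a maximum.
    have hle : ∀ e ∈ Finset.univ, E.rate x e * (h (E.step x e) - h x) ≤ 0 := by
      intro e _
      rcases eq_or_ne (E.rate x e) 0 with h1 | h1
      · simp [h1]
      · refine mul_nonpos_of_nonneg_of_nonpos (E.rate_nonneg x e) ?_
        rw [hxm, sub_nonpos]
        exact hmax _ (E.step_mem_S hx h1)
    have := (Finset.sum_eq_zero_iff_of_nonpos hle).1 (hh x hx) e (Finset.mem_univ e)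
    rcases mul_eq_zero.1 this with h1 | h1
    · exact absurd h1 he.ne'
    · linarith

theorem eq_of_gen_eq_zero {h : E.State → ℝ} (hh : ∀ x ∈ E.S, E.gen h x = 0) :
    ∀ x ∈ E.S, h x = h 0 := by
  intro x hx
  refine le_antisymm (E.le_of_gen_eq_zero hh x hx) ?_
  have := E.le_of_gen_eq_zero (h := fun y => - h y) (fun y hy => ?_) x hx
  · linarith
  · rw [← neg_zero, ← hh y hy, gen, gen, ← Finset.sum_neg_distrib]
    exact Finset.sum_congr rfl fun e _ => by ring

/-- The extension by zero of a function on the admissible states. -/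
def extendZero : (E.S → ℝ) →ₗ[ℝ] E.State → ℝ where
  toFun h x := if hx : x ∈ E.S then h ⟨x, hx⟩ else 0
  map_add' h g := by
    funext x
    by_cases hx : x ∈ E.S <;> simp [hx]
  map_smul' r h := by
    funext x
    by_cases hx : x ∈ E.S <;> simp [hx]

theorem extendZero_coe (h : E.S → ℝ) (x : E.S) : E.extendZero h x = h x := by
  simp [extendZero]

/-- The generator, plus evaluation at the empty state. -/
def shiftedGen : (E.S → ℝ) →ₗ[ℝ] E.S → ℝ where
  toFun h x := E.gen (E.extendZero h) x + E.extendZero h 0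
  map_add' h g := by
    funext x
    simp only [map_add, gen, Pi.add_apply]
    rw [add_add_add_comm, ← Finset.sum_add_distrib]
    congr 1
    exact Finset.sum_congr rfl fun e _ => by ring
  map_smul' r h := by
    funext x
    simp only [map_smul, gen, Pi.smul_apply, smul_eq_mul, RingHom.id_apply]
    rw [mul_add, Finset.mul_sum]
    congr 1
    exact Finset.sum_congr rfl fun e _ => by ring

variable {E}

theorem IsStationary.sum_mul_gen {π : E.State → ℝ} (hπ : E.IsStationary π) (h : E.State → ℝ) :
    ∑ x ∈ E.S, π x * E.gen h x = 0 :=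
  (E.balance_iff π).1 hπ.balance h

theorem IsStationary.eq_const {π : E.State → ℝ} (hπ : E.IsStationary π) {φ h : E.State → ℝ} {c : ℝ}
    (hh : ∀ x ∈ E.S, E.gen h x + c = φ x) : c = ∑ x ∈ E.S, π x * φ x := by
  rw [Finset.sum_congr rfl fun x hx => by rw [← hh x hx]]
  simp_rw [mul_add, Finset.sum_add_distrib, hπ.sum_mul_gen h, ← Finset.sum_mul, hπ.sum_eq_one]
  ring

variable (E)

/-- In finite dimension injectivity suffices. On the kernel, pairing with the stationary law kills
the generator and gives `h 0 = 0`; then `h` is harmonic, hence constantly `h 0`. -/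
theorem shiftedGen_surjective : Function.Surjective E.shiftedGen := by
  rw [← LinearMap.injective_iff_surjective, ← LinearMap.ker_eq_bot, LinearMap.ker_eq_bot']
  intro h hh
  have h1 : ∀ x ∈ E.S, E.gen (E.extendZero h) x + E.extendZero h 0 = 0 := fun x hx =>
    congr_fun hh ⟨x, hx⟩
  have h2 : E.extendZero h 0 = 0 := by
    rw [E.isStationary_stationary.eq_const h1]
    simp
  have h3 : ∀ x ∈ E.S, E.gen (E.extendZero h) x = 0 := fun x hx => by simpa [h2] using h1 x hx
  funext x
  rw [← E.extendZero_coe h x, E.eq_of_gen_eq_zero h3 x x.2, h2]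
  rfl

theorem exists_gen_add_const (φ : E.State → ℝ) :
    ∃ (h : E.State → ℝ) (c : ℝ), ∀ x ∈ E.S, E.gen h x + c = φ x := by
  obtain ⟨h, hh⟩ := E.shiftedGen_surjective fun x => φ x
  exact ⟨E.extendZero h, E.extendZero h 0, fun x hx => congr_fun hh ⟨x, hx⟩⟩

/-- The Poisson equation is solvable. -/
theorem exists_gen_eq {φ : E.State → ℝ} (hφ : ∑ x ∈ E.S, E.stationary x * φ x = 0) :
    ∃ h : E.State → ℝ, ∀ x ∈ E.S, E.gen h x = φ x := by
  obtain ⟨h, c, hh⟩ := E.exists_gen_add_const φ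
  have hc := E.isStationary_stationary.eq_const hh
  rw [hφ] at hc
  exact ⟨h, fun x hx => by rw [← hh x hx, hc, add_zero]⟩

-- Write the indicator of `y` as `gen h + c`: every stationary law assigns `y` the mass `c`.
variable {E} in
theorem IsStationary.eq_stationary {π : E.State → ℝ} (hπ : E.IsStationary π) :
    π = E.stationary := by
  funext y
  by_cases hy : y ∈ E.S
  · obtain ⟨h, c, hh⟩ := E.exists_gen_add_const (Pi.single y 1)
    have h1 := hπ.eq_const hh
    rw [E.isStationary_stationary.eq_const hh] at h1
    simpa [Pi.single_apply, hy] using h1.symm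
  · rw [hπ.eq_zero y hy, E.isStationary_stationary.eq_zero y hy]

theorem existsUnique_isStationary : ∃! π : E.State → ℝ, E.IsStationary π :=
  ⟨E.stationary, E.isStationary_stationary, fun _ hπ => hπ.eq_stationary⟩

end Switch

end EGS

end

/-! ### Summing out the phases -/

noncomputable section

/-- The multinomial theorem divided by `n !`. -/
theorem Finset.sum_piAntidiag_prod_pow_div_factorial {ι : Type*} [Fintype ι] [DecidableEq ι]
    (r : ι → ℝ) (n : ℕ) :
    ∑ x ∈ Finset.univ.piAntidiag n, ∏ i, r i ^ x i / (x i).factorial =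
      (∑ i, r i) ^ n / n.factorial := by
  rw [Finset.sum_pow_eq_sum_piAntidiag, Finset.sum_div]
  refine Finset.sum_congr rfl fun x hx => ?_
  have h := Nat.multinomial_spec Finset.univ x
  rw [(Finset.mem_piAntidiag.1 hx).1] at h
  have h' : (∏ i, ((x i).factorial : ℝ)) * Nat.multinomial Finset.univ x = n.factorial := by
    exact_mod_cast h
  have h1 : (∏ i, ((x i).factorial : ℝ)) ≠ 0 :=
    Finset.prod_ne_zero_iff.2 fun i _ => by positivity
  have h2 : (n.factorial : ℝ) ≠ 0 := by positivity
  rw [Finset.prod_div_distrib, div_eq_div_iff h1 h2, ← h']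
  ring

namespace EGS

namespace Switch

variable {K T : ℕ} (E : Switch K T)

/-- Once the counts are admissible, each flow distributes its sessions over phases freely, so the
sum factors over flows. -/
theorem sum_stateWeight_count {q : Flow K T → ℕ} (hC : ∑ f, q f ≤ E.C)
    (hq : ∀ k, nodeLoad q k ≤ E.c k) :
    ∑ x ∈ E.S with count x = q, E.stateWeight x = E.weight q := by
  have h1 : (E.S.filter fun x => count x = q) =
      Fintype.piFinset fun f => Finset.univ.piAntidiag (q f) := by
    ext x
    simp only [Finset.mem_filter, mem_S, Fintype.mem_piFinset, Finset.mem_piAntidiag]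
    constructor
    · rintro ⟨-, rfl⟩ f
      simp [count]
    · intro h
      have : count x = q := funext fun f => (h f).1
      rw [this]
      exact ⟨⟨hC, hq⟩, rfl⟩
  rw [h1, weight]
  simp only [stateWeight]
  rw [← Finset.prod_univ_sum (fun f => Finset.univ.piAntidiag (q f))
    (fun f y => ∏ i, E.rhoPhase f i ^ y i / (y i).factorial)]
  exact Finset.prod_congr rfl fun f _ => Finset.sum_piAntidiag_prod_pow_div_factorial _ _

theorem sum_stateWeight_total {h : ℕ} (hC : h ≤ E.C) (A : Set (Flow K T → ℕ))
    [DecidablePred (· ∈ A)] :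
    ∑ x ∈ E.S with ∑ f, count x f = h ∧ count x ∈ A, E.stateWeight x =
      ∑ q ∈ (E.Q h).filter (· ∈ A), E.weight q := by
  rw [← Finset.sum_fiberwise_of_maps_to (g := count) (t := (E.Q h).filter (· ∈ A))]
  · refine Finset.sum_congr rfl fun q hq => ?_
    rw [Finset.mem_filter, mem_Q] at hq
    rw [← E.sum_stateWeight_count (hq.1.1 ▸ hC) hq.1.2, Finset.filter_filter]
    refine Finset.sum_congr (Finset.filter_congr fun x _ => ?_) fun _ _ => rfl
    constructor
    · exact fun h => h.2
    · rintro rfl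
      exact ⟨⟨hq.1.1, hq.2⟩, rfl⟩
  · intro x hx
    rw [Finset.mem_filter, mem_S] at hx
    rw [Finset.mem_filter, mem_Q]
    exact ⟨⟨hx.2.1, hx.1.2⟩, hx.2.2⟩

theorem sum_stateWeight_of_count_mem (A : Set (Flow K T → ℕ)) [DecidablePred (· ∈ A)] :
    ∑ x ∈ E.S with count x ∈ A, E.stateWeight x =
      ∑ h ∈ Finset.range (E.C + 1), ∑ q ∈ (E.Q h).filter (· ∈ A), E.weight q := by
  rw [← Finset.sum_fiberwise_of_maps_to (g := fun x => ∑ f, count x f)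
    (t := Finset.range (E.C + 1))]
  · refine Finset.sum_congr rfl fun h hh => ?_
    rw [← E.sum_stateWeight_total (Nat.lt_succ_iff.1 (Finset.mem_range.1 hh)),
      Finset.filter_filter]
    exact Finset.sum_congr (Finset.filter_congr fun x _ => and_comm) fun _ _ => rfl
  · intro x hx
    rw [Finset.mem_filter, mem_S] at hx
    exact Finset.mem_range.2 (Nat.lt_succ_iff.2 hx.1.1)

theorem zero_mem_Q' (i : Flow K T) : (0 : Flow K T → ℕ) ∈ E.Q' i := by
  refine ⟨fun k _ => ?_, fun k _ => ?_⟩ <;> rw [nodeLoad_zero]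
  · exact Nat.zero_le _
  · exact E.c_pos k

theorem sum_stationary_filter (p : E.State → Prop) [DecidablePred p] :
    ∑ x ∈ E.S with p x, E.stationary x = (∑ x ∈ E.S with p x, E.stateWeight x) /
      E.normalization := by
  rw [Finset.sum_div]
  exact Finset.sum_congr rfl fun x hx => E.stationary_of_mem (Finset.mem_filter.1 hx).1

/-- Under the stationary distribution, both nodes of a flow have a free qubit with positive
probability. -/
theorem sum_stationary_Q'_pos (i : Flow K T) :
    0 < ∑ x ∈ E.S with count x ∈ E.Q' i, E.stationary x := by
  refine Finset.sum_pos' (fun x _ => E.isStationary_stationary.nonneg x) ⟨0, ?_, ?_⟩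
  · rw [Finset.mem_filter, count_zero]
    exact ⟨E.zero_mem_S, E.zero_mem_Q' i⟩
  · rw [E.stationary_of_mem E.zero_mem_S, stateWeight_zero]
    exact div_pos one_pos E.normalization_pos

theorem conditional_eq_blockingRatio (i : Flow K T) :
    (∑ x ∈ E.S with ∑ f, count x f = E.C ∧ count x ∈ E.Q' i, E.stationary x) /
      (∑ x ∈ E.S with count x ∈ E.Q' i, E.stationary x) = E.blockingRatio i := by
  rw [sum_stationary_filter, sum_stationary_filter,
    div_div_div_cancel_right₀ E.normalization_pos.ne', E.sum_stateWeight_total le_rfl,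
    sum_stateWeight_of_count_mem, blockingRatio, div_eq_inv_mul]

end Switch

end EGS

end

/-! ### Strong law for martingale differences, and passage to continuous time -/

noncomputable section

/-- The second moment of a sum of bounded martingale differences grows at most linearly. -/
theorem MeasureTheory.integral_sq_sum_martingaleDiff_le {Ω : Type*} {m : MeasurableSpace Ω}
    {P : Measure Ω} [IsProbabilityMeasure P] (ℱ : Filtration ℕ m) {D : ℕ → Ω → ℝ} {B : ℝ}
    (hB : ∀ n ω, |D n ω| ≤ B) (hm : ∀ n, Measurable[ℱ (n + 1)] (D n))
    (hD : ∀ n, P[D n | ℱ n] =ᵐ[P] 0) (n : ℕ) :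
    ∫ ω, (∑ k ∈ Finset.range n, D k ω) ^ 2 ∂P ≤ n * B ^ 2 := by
  have hmD : ∀ n, Measurable (D n) := fun n => (hm n).mono (ℱ.le _) le_rfl
  induction n with
  | zero => simp
  | succ n ih =>
    set S : Ω → ℝ := fun ω => ∑ k ∈ Finset.range n, D k ω with hS
    have hSm : Measurable[ℱ n] S := Finset.measurable_sum _ fun k hk =>
      (hm k).mono (ℱ.mono (Finset.mem_range.1 hk)) le_rfl
    have hSm' : Measurable S := hSm.mono (ℱ.le _) le_rfl
    have hSB : ∀ ω, |S ω| ≤ n * B := fun ω => by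
      refine (Finset.abs_sum_le_sum_abs _ _).trans ?_
      refine (Finset.sum_le_sum fun k _ => hB k ω).trans ?_
      simp
    have hB0 : ∀ ω : Ω, 0 ≤ B := fun ω => (abs_nonneg _).trans (hB 0 ω)
    have hiD : Integrable (D n) P := .of_bound (hmD n).aestronglyMeasurable B (ae_of_all _ (hB n))
    have hiSD : Integrable (S * D n) P :=
      .of_bound (hSm'.mul (hmD n)).aestronglyMeasurable (n * B * B) (ae_of_all _ fun ω => by
        rw [Pi.mul_apply, norm_mul]
        exact mul_le_mul (hSB ω) (hB n ω) (abs_nonneg _)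
          (mul_nonneg (Nat.cast_nonneg _) (hB0 ω)))
    have hiS2 : Integrable (fun ω => S ω ^ 2) P :=
      .of_bound (hSm'.pow_const 2).aestronglyMeasurable ((n * B) ^ 2) (ae_of_all _ fun ω => by
        rw [norm_pow]
        exact pow_le_pow_left₀ (norm_nonneg _) (hSB ω) 2)
    have hD2 : ∀ ω, D n ω ^ 2 ≤ B ^ 2 := fun ω => by
      rw [← sq_abs]
      exact pow_le_pow_left₀ (abs_nonneg _) (hB n ω) 2
    have hiD2 : Integrable (fun ω => D n ω ^ 2) P :=
      .of_bound ((hmD n).pow_const 2).aestronglyMeasurable (B ^ 2) (ae_of_all _ fun ω => by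
        rw [Real.norm_of_nonneg (sq_nonneg _)]
        exact hD2 ω)
    -- Martingale orthogonality: `S` is `ℱ n`-measurable and pulls out of the conditional
    -- expectation.
    have horth : ∫ ω, (S * D n) ω ∂P = 0 := by
      rw [← integral_condExp (ℱ.le n)]
      refine integral_eq_zero_of_ae ?_
      filter_upwards [condExp_mul_of_stronglyMeasurable_left hSm.stronglyMeasurable hiSD hiD, hD n]
        with ω h1 h2
      rw [h1, Pi.mul_apply, h2]
      simp
    have hexp : ∀ ω, (∑ k ∈ Finset.range (n + 1), D k ω) ^ 2 =
        S ω ^ 2 + 2 * (S * D n) ω + D n ω ^ 2 := fun ω => by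
      rw [Finset.sum_range_succ, Pi.mul_apply]
      ring
    simp_rw [hexp]
    have hi : Integrable (fun ω => S ω ^ 2 + 2 * (S * D n) ω) P := hiS2.add (hiSD.const_mul 2)
    rw [integral_add hi hiD2, integral_add hiS2 (hiSD.const_mul 2),
      integral_const_mul, horth]
    have : ∫ ω, D n ω ^ 2 ∂P ≤ B ^ 2 := by
      refine (integral_mono hiD2 (integrable_const _) hD2).trans ?_
      simp
    push_cast
    linarith

/-- Averages with bounded increments converge to zero as soon as they do so along the squares. -/
theorem tendsto_average_zero_of_sq {d : ℕ → ℝ} {B : ℝ} (hB : ∀ n, |d n| ≤ B)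
    (h : Tendsto (fun k : ℕ => (∑ j ∈ Finset.range (k ^ 2), d j) / (k : ℝ) ^ 2) atTop (𝓝 0)) :
    Tendsto (fun n : ℕ => (∑ j ∈ Finset.range n, d j) / n) atTop (𝓝 0) := by
  have hsqrt : Tendsto Nat.sqrt atTop atTop :=
    tendsto_atTop_atTop.2 fun b => ⟨b ^ 2, fun a ha => Nat.le_sqrt'.2 ha⟩
  have h1 := (h.comp hsqrt).abs
  have h2 : Tendsto (fun n : ℕ => 2 * B / (Nat.sqrt n : ℝ)) atTop (𝓝 0) :=
    (tendsto_const_div_atTop_nhds_zero_nat (2 * B)).comp hsqrt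
  have h3 := h1.add h2
  rw [abs_zero, add_zero] at h3
  refine squeeze_zero_norm' ?_ h3
  filter_upwards [eventually_ge_atTop 1] with n hn
  set k := Nat.sqrt n with hk
  have hk1 : 1 ≤ k := Nat.le_sqrt'.2 (by simpa using hn)
  have hkn : k ^ 2 ≤ n := Nat.sqrt_le' n
  have hnk : n ≤ k ^ 2 + 2 * k := by
    have := Nat.lt_succ_sqrt n
    rw [← hk] at this
    simp only [Nat.succ_eq_add_one] at this
    nlinarith
  have hB0 : 0 ≤ B := (abs_nonneg _).trans (hB 0)
  have hkR : (1 : ℝ) ≤ k := by exact_mod_cast hk1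
  have hknR : (k : ℝ) ^ 2 ≤ n := by exact_mod_cast hkn
  have hnkR : (n : ℝ) ≤ k ^ 2 + 2 * k := by exact_mod_cast hnk
  -- At most `2 * k` terms lie beyond the last square; divided by `n ≥ k ^ 2` they contribute at
  -- most `2 * B / k`.
  have hsplit : |∑ j ∈ Finset.range n, d j| ≤
      |∑ j ∈ Finset.range (k ^ 2), d j| + 2 * k * B := by
    rw [← Finset.sum_range_add_sum_Ico _ hkn]
    refine (abs_add_le _ _).trans (add_le_add le_rfl ?_)
    refine (Finset.abs_sum_le_sum_abs _ _).trans ((Finset.sum_le_sum fun j _ => hB j).trans ?_)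
    rw [Finset.sum_const, Nat.card_Ico, nsmul_eq_mul, Nat.cast_sub hkn]
    push_cast
    exact mul_le_mul_of_nonneg_right (by linarith) hB0
  have hk2 : (0 : ℝ) < (k : ℝ) ^ 2 := by positivity
  rw [Real.norm_eq_abs, abs_div, Nat.abs_cast]
  calc |∑ j ∈ Finset.range n, d j| / n
      ≤ (|∑ j ∈ Finset.range (k ^ 2), d j| + 2 * k * B) / (k : ℝ) ^ 2 :=
        div_le_div₀ (by positivity) hsplit hk2 hknR
    _ = _ := by
        simp only [Function.comp_apply]
        rw [← hk, abs_div, abs_of_pos hk2]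
        have : (k : ℝ) ≠ 0 := by positivity
        field_simp

/-- The strong law of large numbers for bounded martingale differences. -/
theorem MeasureTheory.ae_tendsto_average_martingaleDiff {Ω : Type*} {m : MeasurableSpace Ω}
    {P : Measure Ω} [IsProbabilityMeasure P] (ℱ : Filtration ℕ m) {D : ℕ → Ω → ℝ} {B : ℝ}
    (hB : ∀ n ω, |D n ω| ≤ B) (hm : ∀ n, Measurable[ℱ (n + 1)] (D n))
    (hD : ∀ n, P[D n | ℱ n] =ᵐ[P] 0) :
    ∀ᵐ ω ∂P, Tendsto (fun n : ℕ => (∑ k ∈ Finset.range n, D k ω) / n) atTop (𝓝 0) := by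
  have hmD : ∀ n, Measurable (D n) := fun n => (hm n).mono (ℱ.le _) le_rfl
  set Y : ℕ → Ω → ℝ := fun k ω =>
    ((∑ j ∈ Finset.range (k ^ 2), D j ω) / (k : ℝ) ^ 2) ^ 2 with hY
  have hYm : ∀ k, Measurable (Y k) := fun k =>
    ((Finset.measurable_sum _ fun j _ => hmD j).div_const _).pow_const 2
  have hYB : ∀ k ω, |∑ j ∈ Finset.range (k ^ 2), D j ω| ≤ (k : ℝ) ^ 2 * B := fun k ω => by
    refine (Finset.abs_sum_le_sum_abs _ _).trans ((Finset.sum_le_sum fun j _ => hB j ω).trans ?_)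
    simp
  have hYi : ∀ k, Integrable (Y k) P := fun k =>
    .of_bound (hYm k).aestronglyMeasurable (((k : ℝ) ^ 2 * B / (k : ℝ) ^ 2) ^ 2)
      (ae_of_all _ fun ω => by
        rw [hY, norm_pow, norm_div, norm_pow, Real.norm_natCast]
        have := hYB k ω
        gcongr
        exact this)
  have hYint : ∀ k, ∫ ω, Y k ω ∂P ≤ B ^ 2 * (1 / (k : ℝ) ^ 2) := by
    intro k
    rcases Nat.eq_zero_or_pos k with rfl | hk
    · simp [hY]
    have h1 := integral_sq_sum_martingaleDiff_le ℱ hB hm hD (k ^ 2)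
    simp_rw [hY, div_pow]
    rw [integral_div, div_le_iff₀ (by positivity)]
    refine h1.trans (le_of_eq ?_)
    have : (k : ℝ) ≠ 0 := by positivity
    push_cast
    field_simp
  have hsum : Summable fun k : ℕ => B ^ 2 * (1 / (k : ℝ) ^ 2) :=
    (Real.summable_one_div_nat_pow.2 one_lt_two).mul_left _
  -- Along squares the second moments are summable, so `∑ Y k` is almost surely finite and its terms
  -- tend to zero.
  have hlint : ∫⁻ ω, ∑' k, ENNReal.ofReal (Y k ω) ∂P ≠ ⊤ := by
    rw [lintegral_tsum fun k => (hYm k).ennreal_ofReal.aemeasurable]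
    refine ne_top_of_le_ne_top hsum.tsum_ofReal_ne_top (ENNReal.tsum_le_tsum fun k => ?_)
    rw [← ofReal_integral_eq_lintegral_ofReal (hYi k) (ae_of_all _ fun ω => sq_nonneg _)]
    exact ENNReal.ofReal_le_ofReal (hYint k)
  filter_upwards [ae_lt_top (Measurable.tsum fun k => (hYm k).ennreal_ofReal) hlint]
    with ω hω
  refine tendsto_average_zero_of_sq (fun n => hB n ω) ?_
  have h1 := ENNReal.tendsto_atTop_zero_of_tsum_ne_top hω.ne
  have h2 := (ENNReal.tendsto_toReal ENNReal.zero_ne_top).comp h1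
  have h3 : Tendsto (fun k => Y k ω) atTop (𝓝 0) := by
    refine h2.congr fun k => ?_
    exact ENNReal.toReal_ofReal (sq_nonneg _)
  have h4 := h3.sqrt
  rw [Real.sqrt_zero] at h4
  refine (tendsto_zero_iff_abs_tendsto_zero _).2 (h4.congr fun k => ?_)
  exact Real.sqrt_sq_eq_abs _

/-- If events occur at increasing times that tend to infinity, then the frequency with respect to
time of one kind of events among those of another kind is the quotient of their frequencies with
respect to the index. -/
theorem tendsto_ncard_div_ncard {T : ℕ → ℝ} (hT : StrictMono T) (hT' : Tendsto T atTop atTop)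
    (p q : ℕ → Prop) [DecidablePred p] [DecidablePred q] {a b : ℝ} (ha : 0 < a)
    (hp : Tendsto (fun n : ℕ => (∑ k ∈ Finset.range n, if p k then (1 : ℝ) else 0) / n) atTop (𝓝 a))
    (hq : Tendsto (fun n : ℕ => (∑ k ∈ Finset.range n, if q k then (1 : ℝ) else 0) / n) atTop
      (𝓝 b)) :
    Tendsto (fun t => {n | T n ≤ t ∧ p n}.ncard) atTop atTop ∧
      Tendsto (fun t => ({n | T n ≤ t ∧ q n}.ncard : ℝ) / ({n | T n ≤ t ∧ p n}.ncard : ℝ)) atTop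
        (𝓝 (b / a)) := by
  -- `N t` counts the events up to time `t`, so each count in the claim is a partial sum up to `N
  -- t`.
  have hN : ∀ t, ∃ N, ∀ n, T n ≤ t ↔ n < N := by
    intro t
    have hex : ∃ n, t < T n := (hT'.eventually_gt_atTop t).exists
    classical
    refine ⟨Nat.find hex, fun n => ⟨fun h => ?_, fun h => not_lt.1 (Nat.find_min hex h)⟩⟩
    by_contra hn
    exact absurd (hT.monotone (not_lt.1 hn)) (not_le.2 (h.trans_lt (Nat.find_spec hex)))
  choose N hN using hN
  have hNt : Tendsto N atTop atTop := tendsto_atTop_atTop.2 fun b =>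
    ⟨T b, fun t ht => ((hN t b).1 ht).le⟩
  have hcard : ∀ (r : ℕ → Prop) [DecidablePred r] (t : ℝ),
      ({n | T n ≤ t ∧ r n}.ncard : ℝ) = ∑ k ∈ Finset.range (N t), if r k then (1 : ℝ) else 0 := by
    intro r _ t
    have : {n | T n ≤ t ∧ r n} = ↑((Finset.range (N t)).filter r) := by
      ext n
      simp [hN]
    rw [this, Set.ncard_coe_finset, Finset.sum_boole]
  have hp' := hp.comp hNt
  have hq' := hq.comp hNt
  have hNt' : Tendsto (fun t => (N t : ℝ)) atTop atTop := tendsto_natCast_atTop_atTop.comp hNt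
  constructor
  · rw [← tendsto_natCast_atTop_iff (R := ℝ)]
    refine (hp'.pos_mul_atTop ha hNt').congr' ?_
    filter_upwards [hNt'.eventually_gt_atTop 0] with t ht
    rw [hcard p]
    exact div_mul_cancel₀ _ ht.ne'
  · refine (hq'.div hp' ha.ne').congr' ?_
    filter_upwards [hNt'.eventually_gt_atTop 0] with t ht
    rw [hcard p, hcard q]
    exact div_div_div_cancel_right₀ ht.ne' _ _

end

/-! ### Ergodic behaviour of trajectories -/

noncomputable section

namespace EGS

namespace Switch

variable {K T : ℕ} (E : Switch K T)

theorem mem_Q'_count_iff {x : E.State} (hx : x ∈ E.S) (i : Flow K T) :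
    count x ∈ E.Q' i ↔ ∀ k, Flow.Has i k → nodeLoad (count x) k < E.c k :=
  ⟨fun h => h.2, fun h => ⟨fun k _ => ((E.mem_S x).1 hx).2 k, h⟩⟩

theorem rate_request {x : E.State} (hx : x ∈ E.S) (i : Flow K T) :
    E.rate x (.inl i) = if count x ∈ E.Q' i then E.ν i else 0 := by
  simp only [rate, E.mem_Q'_count_iff hx]

theorem totalRate_nonneg (x : E.State) : 0 ≤ E.totalRate x :=
  Finset.sum_nonneg fun e _ => E.rate_nonneg x e

-- In the empty state flow `i` can request, as every node has a qubit; any other state has a phase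
-- to complete.
variable {E} in
theorem totalRate_pos {i : Flow K T} (hν : 0 < E.ν i) (x : E.State) : 0 < E.totalRate x := by
  suffices ∃ e, 0 < E.rate x e by
    obtain ⟨e, he⟩ := this
    exact Finset.sum_pos' (fun e _ => E.rate_nonneg x e) ⟨e, Finset.mem_univ e, he⟩
  by_cases h0 : x = 0
  · refine ⟨.inl i, ?_⟩
    rw [h0, E.rate_request E.zero_mem_S, count_zero, if_pos (E.zero_mem_Q' i)]
    exact hν
  · obtain ⟨e, he, -⟩ := E.exists_step_remaining_lt h0
    exact ⟨e, he⟩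

variable {E}

theorem sum_stationary_mul_totalRate_pos (hpos : ∀ x, 0 < E.totalRate x) :
    0 < ∑ x ∈ E.S, E.stationary x * E.totalRate x := by
  refine Finset.sum_pos'
    (fun x _ => mul_nonneg (E.isStationary_stationary.nonneg x) (hpos x).le)
    ⟨0, E.zero_mem_S, mul_pos ?_ (hpos 0)⟩
  rw [E.stationary_of_mem E.zero_mem_S, stateWeight_zero]
  exact div_pos one_pos E.normalization_pos

namespace IsTrajectory

variable {Ω : Type*} {m : MeasurableSpace Ω} {P : Measure Ω}
  {ℱ : Filtration ℕ m} {X : ℕ → Ω → E.State} {τ : ℕ → Ω → ℝ} {ev : ℕ → Ω → E.Event}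
  (h : E.IsTrajectory P ℱ X τ ev)

include h

theorem measurable_comp (g : E.State → ℝ) (n : ℕ) : Measurable[ℱ n] fun ω => g (X n ω) :=
  (Measurable.of_discrete (f := g)).comp (h.measurable_X n)

theorem measurableSet_event_lt (n : ℕ) (e : E.Event) (s : ℝ) :
    MeasurableSet[ℱ (n + 1)] {ω | ev n ω = e ∧ s < τ n ω} :=
  (h.measurable_ev n e).inter (h.measurable_τ n measurableSet_Ioi)

variable [IsProbabilityMeasure P]

/-- Given the past, the holding time is exponential. -/
theorem condExp_holdingTime (hpos : ∀ x, 0 < E.totalRate x) (n : ℕ) {s : ℝ} (hs : 0 ≤ s) :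
    P[Set.indicator {ω | s < τ n ω} (fun _ => (1 : ℝ)) | ℱ n] =ᵐ[P]
      fun ω => Real.exp (-(E.totalRate (X n ω) * s)) := by
  have h1 : Set.indicator {ω | s < τ n ω} (fun _ => (1 : ℝ)) =
      ∑ e, Set.indicator {ω | ev n ω = e ∧ s < τ n ω} (fun _ => (1 : ℝ)) := by
    funext ω
    by_cases hω : s < τ n ω <;> simp [Finset.sum_apply, Set.indicator_apply, hω]
  rw [h1]
  refine (condExp_finsetSum (fun e _ => ?_) _).trans ?_
  · exact (integrable_const _).indicator ((ℱ.le _) _ (h.measurableSet_event_lt n e s))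
  · have h2 := ae_all_iff.2 fun e => h.law n e s hs
    filter_upwards [h2] with ω hω
    rw [Finset.sum_apply, Finset.sum_congr rfl fun e _ => hω e, ← Finset.sum_mul,
      ← Finset.sum_div]
    rw [show ∑ e, E.rate (X n ω) e = E.totalRate (X n ω) from rfl, div_self (hpos _).ne', one_mul]

theorem ae_holdingTime_pos (hpos : ∀ x, 0 < E.totalRate x) : ∀ᵐ ω ∂P, ∀ n, 0 < τ n ω := by
  rw [ae_all_iff]
  intro n
  have hm : MeasurableSet {ω | 0 < τ n ω} :=
    (ℱ.le (n + 1)) _ (h.measurable_τ n measurableSet_Ioi)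
  have h1 := h.condExp_holdingTime hpos n le_rfl
  have h2 : P.real {ω | 0 < τ n ω} = 1 := by
    rw [← integral_indicator_one hm]
    change ∫ ω, Set.indicator {ω | 0 < τ n ω} (fun _ => (1 : ℝ)) ω ∂P = 1
    rw [← integral_condExp (ℱ.le n), integral_congr_ae h1]
    simp
  rw [measureReal_def, ENNReal.toReal_eq_one_iff] at h2
  exact (mem_ae_iff_prob_eq_one hm).2 h2

/-- Given the past, the next event is chosen proportionally to the rates. -/
theorem condExp_event (hpos : ∀ x, 0 < E.totalRate x) (n : ℕ) (e : E.Event) :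
    P[Set.indicator {ω | ev n ω = e} (fun _ => (1 : ℝ)) | ℱ n] =ᵐ[P]
      fun ω => E.rate (X n ω) e / E.totalRate (X n ω) := by
  have h1 : Set.indicator {ω | ev n ω = e} (fun _ => (1 : ℝ)) =ᵐ[P]
      Set.indicator {ω | ev n ω = e ∧ 0 < τ n ω} (fun _ => (1 : ℝ)) := by
    filter_upwards [h.ae_holdingTime_pos hpos] with ω hω
    simp [Set.indicator_apply, hω n]
  refine (condExp_congr_ae h1).trans ((h.law n e 0 le_rfl).trans ?_)
  filter_upwards with ω
  simp

/-- Integrate the conditional law of the event over the past event that its rate is zero. This keeps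
trajectories inside `S`. -/
theorem ae_rate_ne_zero (hpos : ∀ x, 0 < E.totalRate x) (n : ℕ) :
    ∀ᵐ ω ∂P, E.rate (X n ω) (ev n ω) ≠ 0 := by
  suffices H : ∀ e, ∀ᵐ ω ∂P, ¬ (ev n ω = e ∧ E.rate (X n ω) e = 0) by
    rw [← ae_all_iff] at H
    filter_upwards [H] with ω hω h0
    exact hω _ ⟨rfl, h0⟩
  intro e
  have hA : MeasurableSet[ℱ n] {ω | E.rate (X n ω) e = 0} :=
    h.measurable_comp (fun x => E.rate x e) n (measurableSet_singleton 0)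
  have hev : MeasurableSet {ω | ev n ω = e} := (ℱ.le (n + 1)) _ (h.measurable_ev n e)
  have h1 := setIntegral_condExp (μ := P) (ℱ.le n)
    ((integrable_const (1 : ℝ)).indicator hev) hA
  rw [setIntegral_congr_ae (g := fun _ => (0 : ℝ)) ((ℱ.le n) _ hA) (by
    filter_upwards [h.condExp_event hpos n e] with ω hω hω'
    rw [hω, show E.rate (X n ω) e = 0 from hω', zero_div])] at h1
  rw [integral_zero, setIntegral_indicator hev, setIntegral_const, smul_eq_mul, mul_one, eq_comm,
    measureReal_eq_zero_iff] at h1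
  rw [ae_iff]
  refine measure_mono_null (fun ω hω => ?_) h1
  simp only [not_not, Set.mem_ofPred_eq] at hω
  exact ⟨hω.2, hω.1⟩

theorem ae_mem_S (hpos : ∀ x, 0 < E.totalRate x) : ∀ᵐ ω ∂P, ∀ n, X n ω ∈ E.S := by
  rw [ae_all_iff]
  intro n
  induction n with
  | zero => exact h.initial
  | succ n ih =>
    filter_upwards [ih, h.next n, h.ae_rate_ne_zero hpos n] with ω h1 h2 h3
    rw [h2]
    exact E.step_mem_S h1 h3

/-- Rates are bounded on the finite set `S`, so each holding time exceeds 1 with conditional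
probability bounded below. By Lévy's conditional Borel–Cantelli lemma this happens infinitely often.
-/
theorem ae_tendsto_eventTime (hpos : ∀ x, 0 < E.totalRate x) :
    ∀ᵐ ω ∂P, Tendsto (fun n => eventTime τ n ω) atTop atTop := by
  -- Indices are shifted because `τ n` is only `ℱ (n + 1)`-measurable.
  set s : ℕ → Set Ω := fun n => Nat.casesOn n ∅ fun n => {ω | 1 < τ n ω} with hs
  have hsm : ∀ n, MeasurableSet[ℱ n] (s n) := by
    rintro (_ | n)
    · exact @MeasurableSet.empty _ (ℱ 0)
    · exact h.measurable_τ n measurableSet_Ioi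
  set Λ : ℝ := ∑ x ∈ E.S, E.totalRate x
  have hcond : ∀ᵐ ω ∂P, ∀ n, Real.exp (-Λ) ≤ (P[(s (n + 1)).indicator (1 : Ω → ℝ) | ℱ n]) ω := by
    rw [ae_all_iff]
    intro n
    filter_upwards [h.condExp_holdingTime hpos n zero_le_one, h.ae_mem_S hpos] with ω h1 h2
    refine le_of_le_of_eq ?_ h1.symm
    rw [mul_one, Real.exp_le_exp, neg_le_neg_iff]
    exact Finset.single_le_sum (fun x _ => E.totalRate_nonneg x) (h2 n)
  filter_upwards [ae_mem_limsup_atTop_iff P hsm, hcond, h.ae_holdingTime_pos hpos] with ω h1 h2 h3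
  have h4 : ω ∈ limsup s atTop := by
    rw [h1]
    refine tendsto_atTop_mono (fun n => Finset.card_nsmul_le_sum _ _ _ fun k _ => h2 k) ?_
    simp only [Finset.card_range, nsmul_eq_mul]
    exact tendsto_natCast_atTop_atTop.atTop_mul_const (Real.exp_pos _)
  rw [mem_limsup_iff_frequently_mem] at h4
  have h5 : ¬ Summable fun n => τ n ω := by
    intro hsum
    have h6 := hsum.tendsto_atTop_zero.eventually_lt_const one_pos
    obtain ⟨n0, hn0⟩ := eventually_atTop.1 h6
    obtain ⟨n, hn, hmem⟩ := frequently_atTop.1 h4 (n0 + 1)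
    obtain ⟨n, rfl⟩ : ∃ k, n = k + 1 := ⟨n - 1, by omega⟩
    exact lt_asymm (hn0 n (by omega)) hmem
  exact ((not_summable_iff_tendsto_nat_atTop_of_nonneg fun n => (h3 n).le).1 h5).comp
    (tendsto_add_atTop_nat 1)

/-- A function of the state and the next event that is conditionally centered has vanishing
averages. -/
theorem ae_tendsto_average_of_centered (hpos : ∀ x, 0 < E.totalRate x)
    {H : E.State → E.Event → ℝ} (hS : ∀ x, x ∉ E.S → ∀ e, H x e = 0)
    (hH : ∀ x, ∑ e, E.rate x e * H x e = 0) :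
    ∀ᵐ ω ∂P, Tendsto (fun n : ℕ => (∑ k ∈ Finset.range n, H (X k ω) (ev k ω)) / n) atTop
      (𝓝 0) := by
  have hev : ∀ n e, MeasurableSet {ω | ev n ω = e} := fun n e =>
    (ℱ.le (n + 1)) _ (h.measurable_ev n e)
  have hB : ∀ x e, |H x e| ≤ ∑ y ∈ E.S, ∑ e, |H y e| := by
    intro x e
    have hnn : ∀ y ∈ E.S, 0 ≤ ∑ e, |H y e| := fun y _ =>
      Finset.sum_nonneg fun e _ => abs_nonneg _
    by_cases hx : x ∈ E.S
    · exact (Finset.single_le_sum (f := fun e => |H x e|) (fun e _ => abs_nonneg _)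
        (Finset.mem_univ e)).trans (Finset.single_le_sum hnn hx)
    · rw [hS x hx, abs_zero]
      exact Finset.sum_nonneg hnn
  -- Splitting over the event separates a factor known at time `n` from the indicator whose
  -- conditional law is known.
  have hsum : ∀ n, (fun ω => H (X n ω) (ev n ω)) =
      ∑ e, (fun ω => H (X n ω) e) * Set.indicator {ω | ev n ω = e} (fun _ => (1 : ℝ)) := by
    intro n
    funext ω
    simp [Finset.sum_apply, Set.indicator_apply]
  refine ae_tendsto_average_martingaleDiff ℱ (D := fun n ω => H (X n ω) (ev n ω))
    (fun n ω => hB _ _) (fun n => ?_) (fun n => ?_)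
  · rw [hsum n]
    refine (Finset.stronglyMeasurable_sum _ fun e _ => ?_).measurable
    refine Measurable.stronglyMeasurable ?_
    exact ((h.measurable_comp (fun x => H x e) n).mono (ℱ.mono n.le_succ) le_rfl).mul
      (measurable_const.indicator (h.measurable_ev n e))
  · rw [hsum n]
    have hint : ∀ e, Integrable ((fun ω => H (X n ω) e) *
        Set.indicator {ω | ev n ω = e} (fun _ => (1 : ℝ))) P := fun e => by
      refine Integrable.bdd_mul ((integrable_const (1 : ℝ)).indicator (hev n e))
        ((h.measurable_comp (fun x => H x e) n).mono (ℱ.le n) le_rfl).aestronglyMeasurable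
        (ae_of_all _ fun ω => hB _ _)
    refine (condExp_finsetSum (fun e _ => hint e) _).trans ?_
    have h1 : ∀ e, P[(fun ω => H (X n ω) e) *
        Set.indicator {ω | ev n ω = e} (fun _ => (1 : ℝ)) | ℱ n] =ᵐ[P]
        fun ω => H (X n ω) e * (E.rate (X n ω) e / E.totalRate (X n ω)) := fun e => by
      refine (condExp_mul_of_stronglyMeasurable_left
        (h.measurable_comp (fun x => H x e) n).stronglyMeasurable (hint e)
        ((integrable_const (1 : ℝ)).indicator (hev n e))).trans ?_
      filter_upwards [h.condExp_event hpos n e] with ω hω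
      rw [Pi.mul_apply, hω]
    filter_upwards [ae_all_iff.2 h1] with ω hω
    rw [Finset.sum_apply, Finset.sum_congr rfl fun e _ => hω e]
    simp_rw [mul_div_assoc', ← Finset.sum_div]
    rw [Finset.sum_congr rfl fun e _ => mul_comm _ _, hH, zero_div]
    rfl

/-- The ergodic theorem for functions of the state and the next event. -/
theorem ae_tendsto_average (hpos : ∀ x, 0 < E.totalRate x) (G : E.State → E.Event → ℝ) :
    ∀ᵐ ω ∂P, Tendsto (fun n : ℕ => (∑ k ∈ Finset.range n, G (X k ω) (ev k ω)) / n) atTop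
      (𝓝 ((∑ x ∈ E.S, E.stationary x * ∑ e, E.rate x e * G x e) /
        ∑ x ∈ E.S, E.stationary x * E.totalRate x)) := by
  set c := (∑ x ∈ E.S, E.stationary x * ∑ e, E.rate x e * G x e) /
        ∑ x ∈ E.S, E.stationary x * E.totalRate x with hc
  have hZ := sum_stationary_mul_totalRate_pos hpos
  -- `c` is the mean of `G` per event; weighting by `totalRate` passes from the law in time to that
  -- of the jump chain.
  have hφ : ∑ x ∈ E.S, E.stationary x * (c * E.totalRate x - ∑ e, E.rate x e * G x e) = 0 := by
    simp_rw [mul_sub, Finset.sum_sub_distrib, mul_left_comm _ c, ← Finset.mul_sum]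
    rw [hc, div_mul_cancel₀ _ hZ.ne', sub_self]
  obtain ⟨g, hg⟩ := E.exists_gen_eq hφ
  -- Adding the increment of the Poisson solution `g` makes `G - c` conditionally centered; these
  -- increments telescope and `g` is bounded on `S`.
  have hlim := h.ae_tendsto_average_of_centered hpos
    (H := fun x e => if x ∈ E.S then G x e - c + (g (E.step x e) - g x) else 0)
    (fun x hx e => if_neg hx) (fun x => by
      by_cases hx : x ∈ E.S
      · have := hg x hx
        simp only [gen, totalRate] at this
        simp only [if_pos hx, mul_add, mul_sub, Finset.sum_add_distrib, Finset.sum_sub_distrib]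
        simp only [mul_sub, Finset.sum_sub_distrib] at this
        rw [this, ← Finset.sum_mul]
        ring
      · simp [hx])
  have hnext := fun n => h.next n
  rw [← ae_all_iff] at hnext
  filter_upwards [hlim, hnext, h.ae_mem_S hpos] with ω h1 h2 h3
  have h4 : ∀ n, ∑ k ∈ Finset.range n, (if X k ω ∈ E.S then G (X k ω) (ev k ω) - c +
      (g (E.step (X k ω) (ev k ω)) - g (X k ω)) else 0) =
      ∑ k ∈ Finset.range n, G (X k ω) (ev k ω) - n * c + (g (X n ω) - g (X 0 ω)) := by
    intro n
    simp_rw [if_pos (h3 _), ← h2]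
    rw [Finset.sum_add_distrib, Finset.sum_range_sub (fun k => g (X k ω)),
      Finset.sum_sub_distrib]
    simp
  have hgB : ∀ x ∈ E.S, |g x| ≤ ∑ y ∈ E.S, |g y| := fun x hx =>
    Finset.single_le_sum (f := fun y => |g y|) (fun y _ => abs_nonneg _) hx
  have h5 : Tendsto (fun n : ℕ => (g (X n ω) - g (X 0 ω)) / n) atTop (𝓝 0) := by
    refine squeeze_zero_norm (fun n => ?_)
      (tendsto_const_div_atTop_nhds_zero_nat (2 * ∑ y ∈ E.S, |g y|))
    rw [norm_div, Real.norm_natCast, Real.norm_eq_abs]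
    gcongr
    have := abs_sub (g (X n ω)) (g (X 0 ω))
    linarith [hgB _ (h3 n), hgB _ (h3 0)]
  have h6 := (h1.sub h5).add_const c
  rw [sub_zero, zero_add] at h6
  refine h6.congr' ?_
  filter_upwards [eventually_ge_atTop 1] with n hn
  rw [h4]
  have : (n : ℝ) ≠ 0 := by positivity
  field_simp
  ring

/-- The long-run frequency, among all events, of the requests of a flow that arrive in a state with a
given property. -/
theorem ae_tendsto_average_request (hpos : ∀ x, 0 < E.totalRate x) (i : Flow K T)
    (p : E.State → Prop) [DecidablePred p] :
    ∀ᵐ ω ∂P, Tendsto (fun n : ℕ => (∑ k ∈ Finset.range n,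
      if ev k ω = .inl i ∧ p (X k ω) then (1 : ℝ) else 0) / n) atTop
      (𝓝 (E.ν i * (∑ x ∈ E.S with p x ∧ count x ∈ E.Q' i, E.stationary x) /
        ∑ x ∈ E.S, E.stationary x * E.totalRate x)) := by
  convert h.ae_tendsto_average hpos (fun x e => if e = .inl i ∧ p x then (1 : ℝ) else 0) using 6
  rw [Finset.mul_sum, Finset.sum_filter]
  refine Finset.sum_congr rfl fun x hx => ?_
  rw [Finset.sum_eq_single (.inl i)]
  · rw [E.rate_request hx]
    by_cases h1 : p x <;> by_cases h2 : count x ∈ E.Q' i <;> simp [h1, h2, mul_comm]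
  · intro e _ he
    simp [he]
  · simp

theorem ae_tendsto_blocked {i : Flow K T} (hν : 0 < E.ν i) :
    ∀ᵐ ω ∂P, Tendsto (fun t : ℝ => numRequests τ ev i t ω) atTop atTop ∧
      Tendsto (fun t : ℝ => (numBlocked X τ ev i t ω : ℝ) / (numRequests τ ev i t ω : ℝ)) atTop
        (𝓝 (E.blockingRatio i)) := by
  have hpos := totalRate_pos hν
  have hZ := sum_stationary_mul_totalRate_pos hpos
  have hQ := E.sum_stationary_Q'_pos i
  filter_upwards [h.ae_holdingTime_pos hpos, h.ae_tendsto_eventTime hpos,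
    h.ae_tendsto_average_request hpos i fun _ => True,
    h.ae_tendsto_average_request hpos i fun x => ∑ f, count x f = E.C] with ω h1 h2 h3 h4
  have hmono : StrictMono fun n => eventTime τ n ω := strictMono_nat_of_lt_succ fun n => by
    simp only [eventTime]
    rw [Finset.sum_range_succ _ (n + 1)]
    linarith [h1 (n + 1)]
  simp only [true_and, and_true] at h3
  let hdec : DecidablePred fun n => ev n ω = .inl i := fun _ => instDecidableEqSum _ _
  have := tendsto_ncard_div_ncard hmono h2 (fun n => ev n ω = .inl i)
    (fun n => ev n ω = .inl i ∧ ∑ f, count (X n ω) f = E.C) (div_pos (mul_pos hν hQ) hZ) h3 h4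
  -- The total event rate and `ν i` cancel: arrivals of flow `i` see the stationary law conditioned
  -- on free qubits.
  rwa [div_div_div_cancel_right₀ hZ.ne', mul_div_mul_left _ _ hν.ne',
    E.conditional_eq_blockingRatio i] at this

end IsTrajectory

end Switch

end EGS

end

theorem theorem2 {K T : ℕ} (E : EGS.Switch K T) (i : EGS.Flow K T) (hν : 0 < E.ν i) :
    -- the stationary distribution is unique, and under it `blockingRatio` is the conditional
    -- probability that all resources are engaged, given that flow `i` has free qubits
    (∃! π : E.State → ℝ, E.IsStationary π) ∧
    (∀ π : E.State → ℝ, E.IsStationary π →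
      0 < ∑ x ∈ E.S with EGS.Switch.count x ∈ E.Q' i, π x ∧
      (∑ x ∈ E.S with ∑ f, EGS.Switch.count x f = E.C ∧ EGS.Switch.count x ∈ E.Q' i, π x) /
        (∑ x ∈ E.S with EGS.Switch.count x ∈ E.Q' i, π x) = E.blockingRatio i) ∧
    -- from any initial state, almost surely the fraction of blocked requests among the requests
    -- of flow `i` that arrive up to time `t` converges to `blockingRatio`
    (∀ {Ω : Type*} {m : MeasurableSpace Ω} (P : Measure Ω) [IsProbabilityMeasure P]
      (ℱ : Filtration ℕ m) (X : ℕ → Ω → E.State) (τ : ℕ → Ω → ℝ) (ev : ℕ → Ω → E.Event),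
      E.IsTrajectory P ℱ X τ ev →
      ∀ᵐ ω ∂P,
        Tendsto (fun t : ℝ => EGS.Switch.numRequests τ ev i t ω) atTop atTop ∧
        Tendsto (fun t : ℝ => (EGS.Switch.numBlocked X τ ev i t ω : ℝ) /
          (EGS.Switch.numRequests τ ev i t ω : ℝ)) atTop (𝓝 (E.blockingRatio i))) := by
  refine ⟨E.existsUnique_isStationary, fun π hπ => ?_, ?_⟩
  · rw [hπ.eq_stationary]
    exact ⟨E.sum_stationary_Q'_pos i, E.conditional_eq_blockingRatio i⟩
  · intro Ω m P _ ℱ X τ ev h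
    exact h.ae_tendsto_blocked hν
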